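/- Let $n\ge 1$, let $A\in\mathbb{R}^{n\times n}$, $b\in\mathbb{R}^n$ be such that the controllability matrix $[\,b,\,Ab,\dots,A^{n-1}b\,]$ is nonsingular, let $z_0\in\mathbb{R}^n$, $v_{\min}\le v_{\max}$ be real numbers and $t>0$. Let $q^\top$ be the last row of the inverse of the controllability matrix, let $M$ be the matrix with rows $q^\top,q^\top A,\dots,q^\top A^{n-1}$, let $A_{\rm con}=MAM^{-1}$, $b_{\rm con}=Mb=(0,\dots,0,1)^\top$, $x_0=Mz_0$, and let $c=(c_0,\dots,c_{n-1})^\top$ be the vector of the lower coefficients of the monic characteristic polynomial $\lambda^n+c_{n-1}\lambda^{n-1}+\dots+c_0$ of $A$. For $0\le s\le t$ put $f_s(\tau)=\langle c,e^{(s-\tau)A_{\rm con}}b_{\rm con}\rangle$ and let $I_{\min}(s)$ and $I_{\max}(s)$ be the infimum and the supremum of $v(s)-\int_0^s f_s(\tau)v(\tau)\,d\tau$ over the continuous $v:[0,s]\to[v_{\min},v_{\max}]$. These are finite and $$I_{\min}(s)=v_{\min}-v_{\min}\int_{\{\tau\in[0,s]:f_s(\tau)\le0\}}f_s\,d\tau-v_{\max}\int_{\{\tau\in[0,s]:f_s(\tau)>0\}}f_s\,d\tau,$$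 $$I_{\max}(s)=v_{\max}-v_{\max}\int_{\{\tau\in[0,s]:f_s(\tau)\le0\}}f_s\,d\tau-v_{\min}\int_{\{\tau\in[0,s]:f_s(\tau)>0\}}f_s\,d\tau.$$ Put $u_{\min}(s)=-\langle c,e^{sA_{\rm con}}Mz_0\rangle+I_{\min}(s)$, $u_{\max}(s)=-\langle c,e^{sA_{\rm con}}Mz_0\rangle+I_{\max}(s)$, $\mu=(u_{\max}-u_{\min})/2$ and $\nu=(u_{\max}+u_{\min})/2$. Let $\mathcal{X}_t\subset\mathbb{R}^n$ be the set of all $x(t)$, where $x$ solves $\dot x=A_{\rm int}x+b_{\rm con}u$ on $[0,t]$, $x(0)=x_0$, for some continuous $u$ on $[0,t]$ with $u(s)\in[u_{\min}(s),u_{\max}(s)]$ for all $s\in[0,t]$; here $A_{\rm int}$ is the $n\times n$ matrix with ones on the first superdiagonal and zeros elsewhere. Let $$\chi_k=\sum_{\ell=k}^n\frac{t^{\ell-k}}{(\ell-k)!}(x_0)_\ell\quad(1\le k\le n),\qquad \xi(s)=\Big(\frac{s^{n-1}}{(n-1)!},\frac{s^{n-2}}{(n-2)!},\dots,s,1\Big)^{\top},$$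 $\mathcal{W}_t=\{\sigma\in\mathbb{R}^{n-1}:0\le\sigma_1\le\dots\le\sigma_{n-1}\le t\}$ and, with $\sigma_0=0$ and $\sigma_n=t$, $$x^{\rm upper}(\sigma)=\chi+\int_0^t\nu(s)\xi(t-s)\,ds+\sum_{k=1}^{n}(-1)^{k-1}\int_{\sigma_{k-1}}^{\sigma_k}\mu(s)\xi(t-s)\,ds,$$ $$x^{\rm lower}(\sigma)=\chi+\int_0^t\nu(s)\xi(t-s)\,ds-\sum_{k=1}^{n}(-1)^{k-1}\int_{\sigma_{k-1}}^{\sigma_k}\mu(s)\xi(t-s)\,ds.$$ Then the topological boundary of $\mathcal{X}_t$ is the union of an upper and a lower bounding surface, $$\partial\mathcal{X}_t=\{x^{\rm upper}(\sigma):\sigma\in\mathcal{W}_t\}\cup\{x^{\rm lower}(\sigma):\sigma\in\mathcal{W}_t\}.$$ -/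

import Mathlib

open scoped Matrix

noncomputable section

namespace Reach

/-! Throughout the state dimension is `n = m + 1 ≥ 1`; vectors of `ℝⁿ` are functions
`Fin (m + 1) → ℝ` and the component with one-based index `k + 1` has index `k`. -/

/-- The controllability matrix `[b, A b, …, A ^ (n - 1) b]`. -/
def ctrbMatrix {m : ℕ} (A : Matrix (Fin (m + 1)) (Fin (m + 1)) ℝ) (b : Fin (m + 1) → ℝ) :
    Matrix (Fin (m + 1)) (Fin (m + 1)) ℝ :=
  Matrix.of fun i j => ((A ^ (j : ℕ)) *ᵥ b) i

/-- `(A, b)` is a controllable pair: the controllability matrix has full rank. -/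
def IsControllable {m : ℕ} (A : Matrix (Fin (m + 1)) (Fin (m + 1)) ℝ)
    (b : Fin (m + 1) → ℝ) : Prop :=
  (ctrbMatrix A b).rank = m + 1

/-- The last row `qᵀ` of the inverse of the controllability matrix. -/
def qRow {m : ℕ} (A : Matrix (Fin (m + 1)) (Fin (m + 1)) ℝ) (b : Fin (m + 1) → ℝ) :
    Fin (m + 1) → ℝ :=
  fun j => (ctrbMatrix A b)⁻¹ (Fin.last m) j

/-- The matrix `M` with rows `qᵀ, qᵀ A, …, qᵀ A ^ (n - 1)`. -/
def canonM {m : ℕ} (A : Matrix (Fin (m + 1)) (Fin (m + 1)) ℝ) (b : Fin (m + 1) → ℝ) :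
    Matrix (Fin (m + 1)) (Fin (m + 1)) ℝ :=
  Matrix.of fun i j => (qRow A b ᵥ* (A ^ (i : ℕ))) j

/-- The state matrix `M A M⁻¹` of the controllable canonical form. -/
def Acon {m : ℕ} (A : Matrix (Fin (m + 1)) (Fin (m + 1)) ℝ) (b : Fin (m + 1) → ℝ) :
    Matrix (Fin (m + 1)) (Fin (m + 1)) ℝ :=
  canonM A b * A * (canonM A b)⁻¹

/-- The input vector `M b` of the controllable canonical form. -/
def bcon {m : ℕ} (A : Matrix (Fin (m + 1)) (Fin (m + 1)) ℝ) (b : Fin (m + 1) → ℝ) :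
    Fin (m + 1) → ℝ :=
  canonM A b *ᵥ b

/-- The coefficients `(c₀, …, c_{n-1})` of the characteristic polynomial
`λ ^ n + c_{n-1} λ ^ (n - 1) + ⋯ + c₀` of `A`. -/
def charCoeff {m : ℕ} (A : Matrix (Fin (m + 1)) (Fin (m + 1)) ℝ) : Fin (m + 1) → ℝ :=
  fun i => A.charpoly.coeff (i : ℕ)

/-- The state matrix of the `n`th order integrator: ones on the first superdiagonal. -/
def Aint (m : ℕ) : Matrix (Fin (m + 1)) (Fin (m + 1)) ℝ :=
  Matrix.of fun i j => if (j : ℕ) = (i : ℕ) + 1 then 1 else 0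

/-- `f(τ) = ⟨c, exp ((s - τ) A_con) b_con⟩`, with the dependence on `s` made explicit. -/
def kernelF {m : ℕ} (A : Matrix (Fin (m + 1)) (Fin (m + 1)) ℝ) (b : Fin (m + 1) → ℝ)
    (s τ : ℝ) : ℝ :=
  charCoeff A ⬝ᵥ (NormedSpace.exp ((s - τ) • Acon A b) *ᵥ bcon A b)

/-- The functional `I(v) = v(s) - ∫₀ˢ f(τ) v(τ) dτ`. -/
def functionalI {m : ℕ} (A : Matrix (Fin (m + 1)) (Fin (m + 1)) ℝ) (b : Fin (m + 1) → ℝ)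
    (s : ℝ) (v : ℝ → ℝ) : ℝ :=
  v s - ∫ τ in (0 : ℝ)..s, kernelF A b s τ * v τ

/-- The values `I(v)` over the continuous `v` on `[0, s]` with `vmin ≤ v ≤ vmax`. -/
def valuesI {m : ℕ} (A : Matrix (Fin (m + 1)) (Fin (m + 1)) ℝ) (b : Fin (m + 1) → ℝ)
    (vmin vmax s : ℝ) : Set ℝ :=
  {r | ∃ v : ℝ → ℝ, ContinuousOn v (Set.Icc 0 s) ∧
    (∀ τ ∈ Set.Icc 0 s, v τ ∈ Set.Icc vmin vmax) ∧ r = functionalI A b s v}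

def Imin {m : ℕ} (A : Matrix (Fin (m + 1)) (Fin (m + 1)) ℝ) (b : Fin (m + 1) → ℝ)
    (vmin vmax s : ℝ) : ℝ :=
  sInf (valuesI A b vmin vmax s)

def Imax {m : ℕ} (A : Matrix (Fin (m + 1)) (Fin (m + 1)) ℝ) (b : Fin (m + 1) → ℝ)
    (vmin vmax s : ℝ) : ℝ :=
  sSup (valuesI A b vmin vmax s)

/-- `∫ f` over the zero sublevel set of `f` in `[0, s]`. -/
def intSub {m : ℕ} (A : Matrix (Fin (m + 1)) (Fin (m + 1)) ℝ) (b : Fin (m + 1) → ℝ)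
    (s : ℝ) : ℝ :=
  ∫ τ in {τ | τ ∈ Set.Icc 0 s ∧ kernelF A b s τ ≤ 0}, kernelF A b s τ

/-- `∫ f` over the strict zero superlevel set of `f` in `[0, s]`. -/
def intSuper {m : ℕ} (A : Matrix (Fin (m + 1)) (Fin (m + 1)) ℝ) (b : Fin (m + 1) → ℝ)
    (s : ℝ) : ℝ :=
  ∫ τ in {τ | τ ∈ Set.Icc 0 s ∧ 0 < kernelF A b s τ}, kernelF A b s τ

/-- The lower end `-⟨c, exp (s A_con) M z₀⟩ + I_min(s)` of the time-varying range. -/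
def umin {m : ℕ} (A : Matrix (Fin (m + 1)) (Fin (m + 1)) ℝ) (b z₀ : Fin (m + 1) → ℝ)
    (vmin vmax s : ℝ) : ℝ :=
  -(charCoeff A ⬝ᵥ (NormedSpace.exp (s • Acon A b) *ᵥ (canonM A b *ᵥ z₀)))
    + Imin A b vmin vmax s

/-- The upper end `-⟨c, exp (s A_con) M z₀⟩ + I_max(s)` of the time-varying range. -/
def umax {m : ℕ} (A : Matrix (Fin (m + 1)) (Fin (m + 1)) ℝ) (b z₀ : Fin (m + 1) → ℝ)
    (vmin vmax s : ℝ) : ℝ :=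
  -(charCoeff A ⬝ᵥ (NormedSpace.exp (s • Acon A b) *ᵥ (canonM A b *ᵥ z₀)))
    + Imax A b vmin vmax s

/-- The reach set at time `t` from `x₀` of `ẋ = F x + g u` over the continuous inputs `u` on
`[0, t]` with `u(s) ∈ [lo(s), hi(s)]` for all `s ∈ [0, t]`. -/
def reachSet {m : ℕ} (F : Matrix (Fin (m + 1)) (Fin (m + 1)) ℝ) (g : Fin (m + 1) → ℝ)
    (lo hi : ℝ → ℝ) (t : ℝ) (x₀ : Fin (m + 1) → ℝ) : Set (Fin (m + 1) → ℝ) :=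
  {y | ∃ (u : ℝ → ℝ) (x : ℝ → Fin (m + 1) → ℝ),
    ContinuousOn u (Set.Icc 0 t) ∧
    (∀ s ∈ Set.Icc 0 t, u s ∈ Set.Icc (lo s) (hi s)) ∧
    x 0 = x₀ ∧
    (∀ s ∈ Set.Icc 0 t, HasDerivWithinAt x (F *ᵥ x s + u s • g) (Set.Icc 0 t) s) ∧
    y = x t}

/-- `χ_k(t, x₀) = ∑_{ℓ ≥ k} t ^ (ℓ - k) / (ℓ - k)! * x₀_ℓ`. -/
def chi {m : ℕ} (t : ℝ) (x₀ : Fin (m + 1) → ℝ) : Fin (m + 1) → ℝ :=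
  fun k => ∑ l : Fin (m + 1),
    if k ≤ l then t ^ ((l : ℕ) - (k : ℕ)) / (((l : ℕ) - (k : ℕ)).factorial : ℝ) * x₀ l else 0

/-- `ξ(s) = (s ^ (n - 1) / (n - 1)!, …, s, 1)`. -/
def xi (m : ℕ) (s : ℝ) : Fin (m + 1) → ℝ :=
  fun k => s ^ (m - (k : ℕ)) / ((m - (k : ℕ)).factorial : ℝ)

/-- The set of `σ ∈ ℝ ^ (n - 1)` with `0 ≤ σ₁ ≤ ⋯ ≤ σ_{n-1} ≤ t`. -/
def weylChamber (m : ℕ) (t : ℝ) : Set (Fin m → ℝ) :=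
  {σ | Monotone σ ∧ ∀ i, σ i ∈ Set.Icc 0 t}

/-- The `n + 1` points `0, σ₁, …, σ_{n-1}, t`. -/
def nodes {m : ℕ} (t : ℝ) (σ : Fin m → ℝ) : Fin (m + 2) → ℝ :=
  Fin.cons 0 (Fin.snoc σ t : Fin (m + 1) → ℝ)

/-- `∫₀^σ₁ μ(s) ξ(t-s) ds - ∫_σ₁^σ₂ μ(s) ξ(t-s) ds + ⋯ + (-1)^(n-1) ∫_σ_{n-1}^t μ(s) ξ(t-s) ds`. -/
def alternating {m : ℕ} (μ : ℝ → ℝ) (t : ℝ) (σ : Fin m → ℝ) : Fin (m + 1) → ℝ :=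
  ∑ k : Fin (m + 1), (-1 : ℝ) ^ (k : ℕ) •
    ∫ s in (nodes t σ k.castSucc)..(nodes t σ k.succ), μ s • xi m (t - s)

/-- The half-width of the range `[lo, hi]`. -/
def halfWidth (lo hi : ℝ → ℝ) (s : ℝ) : ℝ := (hi s - lo s) / 2

/-- The midpoint of the range `[lo, hi]`. -/
def midpt (lo hi : ℝ → ℝ) (s : ℝ) : ℝ := (hi s + lo s) / 2

def xUpper {m : ℕ} (lo hi : ℝ → ℝ) (t : ℝ) (x₀ : Fin (m + 1) → ℝ) (σ : Fin m → ℝ) :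
    Fin (m + 1) → ℝ :=
  chi t x₀ + (∫ s in (0 : ℝ)..t, midpt lo hi s • xi m (t - s)) +
    alternating (halfWidth lo hi) t σ

def xLower {m : ℕ} (lo hi : ℝ → ℝ) (t : ℝ) (x₀ : Fin (m + 1) → ℝ) (σ : Fin m → ℝ) :
    Fin (m + 1) → ℝ :=
  chi t x₀ + (∫ s in (0 : ℝ)..t, midpt lo hi s • xi m (t - s)) -
    alternating (halfWidth lo hi) t σ

def upperSurface {m : ℕ} (lo hi : ℝ → ℝ) (t : ℝ) (x₀ : Fin (m + 1) → ℝ) :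
    Set (Fin (m + 1) → ℝ) :=
  xUpper lo hi t x₀ '' weylChamber m t

def lowerSurface {m : ℕ} (lo hi : ℝ → ℝ) (t : ℝ) (x₀ : Fin (m + 1) → ℝ) :
    Set (Fin (m + 1) → ℝ) :=
  xLower lo hi t x₀ '' weylChamber m t

end Reach

end

open Filter Topology MeasureTheory Set

namespace Reach

section Moment

variable {E : Type*} [NormedAddCommGroup E] [NormedSpace ℝ E]

/-- A convex set in a finite-dimensional space has a supporting functional at every point of its
frontier. -/
theorem exists_support_of_mem_frontier [FiniteDimensional ℝ E] {K : Set E} (hK : Convex ℝ K)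
    {y : E} (hy : y ∈ frontier K) :
    ∃ f : E →L[ℝ] ℝ, f ≠ 0 ∧ ∀ a ∈ K, f a ≤ f y := by
  have hyc : y ∈ closure K := hy.1
  by_cases hinter : (interior K).Nonempty
  · obtain ⟨f, u, hf, h1, h2⟩ := geometric_hahn_banach_of_nonempty_interior hK
      (convex_singleton y) (Set.disjoint_singleton_right.2 hy.2) hinter (Set.singleton_nonempty y)
    exact ⟨f, hf, fun a ha => (h1 a ha).trans (h2 y rfl)⟩
  · obtain ⟨a₀, ha₀⟩ : K.Nonempty := closure_nonempty_iff.1 ⟨y, hyc⟩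
    rw [hK.interior_nonempty_iff_affineSpan_eq_top,
      AffineSubspace.affineSpan_eq_top_iff_vectorSpan_eq_top_of_nonempty ℝ E E ⟨a₀, ha₀⟩] at hinter
    obtain ⟨f, hf, hle⟩ := Submodule.exists_le_ker_of_lt_top _ (lt_top_iff_ne_top.2 hinter)
    have hconst : ∀ a ∈ K, f a = f a₀ := fun a ha => by
      have : f (a -ᵥ a₀) = 0 := hle (vsub_mem_vectorSpan ℝ ha ha₀)
      rw [vsub_eq_sub, map_sub] at this
      linarith
    refine ⟨f.toContinuousLinearMap, fun h => hf ?_, fun a ha => ?_⟩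
    · ext x
      simpa using congrArg (fun g : E →L[ℝ] ℝ => g x) h
    · have hcl : IsClosed {x : E | f.toContinuousLinearMap x = f a₀} :=
        isClosed_eq f.toContinuousLinearMap.continuous continuous_const
      have : f.toContinuousLinearMap y = f a₀ := closure_minimal (fun x hx => hconst x hx) hcl hyc
      rw [this]
      exact (hconst a ha).le

/-- The integrals `∫ w Z` against the continuous weights `w` with `|w| ≤ 1`. -/
def momentSet (Z : ℝ → E) (t : ℝ) : Set E :=
  {y | ∃ w : ℝ → ℝ, Continuous w ∧ (∀ s, |w s| ≤ 1) ∧ y = ∫ s in (0 : ℝ)..t, w s • Z s}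

theorem intervalIntegrable_smul_of_continuous {Z : ℝ → E} (hZ : Continuous Z) {w : ℝ → ℝ}
    (hw : Continuous w) (a b : ℝ) : IntervalIntegrable (fun s => w s • Z s) volume a b :=
  (hw.smul hZ).intervalIntegrable a b

theorem convex_momentSet {Z : ℝ → E} (hZ : Continuous Z) (t : ℝ) :
    Convex ℝ (momentSet Z t) := by
  rintro _ ⟨v, hv, hv1, rfl⟩ _ ⟨w, hw, hw1, rfl⟩ a b ha hb hab
  refine ⟨fun s => a * v s + b * w s, by fun_prop, fun s => ?_, ?_⟩
  · have h1 := abs_le.1 (hv1 s)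
    have h2 := abs_le.1 (hw1 s)
    rw [abs_le]
    constructor <;> nlinarith
  · simp only [add_smul, mul_smul]
    have h1 : IntervalIntegrable (fun s => a • v s • Z s) volume 0 t :=
      (intervalIntegrable_smul_of_continuous hZ hv 0 t).smul a
    have h2 : IntervalIntegrable (fun s => b • w s • Z s) volume 0 t :=
      (intervalIntegrable_smul_of_continuous hZ hw 0 t).smul b
    rw [intervalIntegral.integral_add h1 h2,
      intervalIntegral.integral_smul, intervalIntegral.integral_smul]

/-- A continuous approximation of the sign of a real number. -/
noncomputable def softSign (k : ℕ) (x : ℝ) : ℝ := x / (|x| + 1 / ((k : ℝ) + 1))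

theorem softSign_den_pos (k : ℕ) (x : ℝ) : 0 < |x| + 1 / ((k : ℝ) + 1) := by positivity

theorem continuous_softSign (k : ℕ) : Continuous (softSign k) :=
  continuous_id.div (by fun_prop) fun x => (softSign_den_pos k x).ne'

theorem abs_softSign_le_one (k : ℕ) (x : ℝ) : |softSign k x| ≤ 1 := by
  have h := softSign_den_pos k x
  rw [softSign, abs_div, abs_of_pos h, div_le_one h]
  have : 0 < 1 / ((k : ℝ) + 1) := by positivity
  linarith

theorem tendsto_softSign (x : ℝ) : Tendsto (fun k => softSign k x) atTop (𝓝 (x / |x|)) := by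
  rcases eq_or_ne x 0 with rfl | hx
  · simp [softSign]
  · have h := (tendsto_one_div_add_atTop_nhds_zero_nat (𝕜 := ℝ)).const_add |x|
    rw [add_zero] at h
    exact tendsto_const_nhds.div h (abs_ne_zero.2 hx)

theorem abs_div_abs_le_one (x : ℝ) : |(x / |x|)| ≤ 1 := by
  rw [abs_div, abs_abs]
  exact div_self_le_one _

theorem div_abs_mul_self (x : ℝ) : x / |x| * x = |x| := by
  rcases eq_or_ne x 0 with rfl | hx
  · simp
  · rw [div_mul_eq_mul_div, ← abs_mul_abs_self, mul_div_assoc, div_self (abs_ne_zero.2 hx), mul_one]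

theorem intervalIntegrable_sign_smul {Z : ℝ → E} (hZ : Continuous Z) {h : ℝ → ℝ}
    (hh : Continuous h) (a b : ℝ) :
    IntervalIntegrable (fun s => (h s / |h s|) • Z s) volume a b := by
  refine (hZ.norm.intervalIntegrable a b).mono_fun ?_ (ae_of_all _ fun s => ?_)
  · exact ((hh.measurable.div hh.abs.measurable).aestronglyMeasurable).smul
      hZ.aestronglyMeasurable
  · simp only [norm_smul, Real.norm_eq_abs, abs_norm]
    exact mul_le_of_le_one_left (norm_nonneg _) (abs_div_abs_le_one _)

/-- Dominated convergence for weights bounded by one. -/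
theorem tendsto_integral_weight {Z : ℝ → E} (hZ : Continuous Z) {t : ℝ} (ht : 0 ≤ t)
    {w : ℕ → ℝ → ℝ} (hw : ∀ k, Continuous (w k)) (hw1 : ∀ k s, |w k s| ≤ 1) {g : ℝ → ℝ}
    (hg : ∀ᵐ s ∂(volume.restrict (Ioc 0 t)), Tendsto (fun k => w k s) atTop (𝓝 (g s))) :
    Tendsto (fun k => ∫ s in (0 : ℝ)..t, w k s • Z s) atTop
      (𝓝 (∫ s in (0 : ℝ)..t, g s • Z s)) := by
  refine intervalIntegral.tendsto_integral_filter_of_dominated_convergence (fun s => ‖Z s‖)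
    (Eventually.of_forall fun k => ((hw k).smul hZ).aestronglyMeasurable)
    (Eventually.of_forall fun k => ae_of_all _ fun s _ => ?_)
    (hZ.norm.intervalIntegrable _ _) ?_
  · rw [norm_smul, Real.norm_eq_abs]
    exact mul_le_of_le_one_left (norm_nonneg _) (hw1 k s)
  · rw [ae_restrict_iff' measurableSet_Ioc] at hg
    filter_upwards [hg] with s hs hst
    rw [uIoc_of_le ht] at hst
    exact (hs hst).smul_const _

theorem integral_sign_mem_closure {Z : ℝ → E} (hZ : Continuous Z) {t : ℝ} (ht : 0 ≤ t)
    {h : ℝ → ℝ} (hh : Continuous h) :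
    ∫ s in (0 : ℝ)..t, (h s / |h s|) • Z s ∈ closure (momentSet Z t) := by
  refine mem_closure_of_tendsto (tendsto_integral_weight hZ ht
    (w := fun k s => softSign k (h s)) (fun k => (continuous_softSign k).comp hh)
    (fun k s => abs_softSign_le_one k _) (ae_of_all _ fun s => tendsto_softSign _))
    (Eventually.of_forall fun k => ?_)
  exact ⟨_, (continuous_softSign k).comp hh, fun s => abs_softSign_le_one k _, rfl⟩

variable [CompleteSpace E]

theorem apply_integral_weight {Z : ℝ → E} (f : E →L[ℝ] ℝ) {t : ℝ} {w : ℝ → ℝ}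
    (hw : IntervalIntegrable (fun s => w s • Z s) volume 0 t) :
    f (∫ s in (0 : ℝ)..t, w s • Z s) = ∫ s in (0 : ℝ)..t, w s * f (Z s) := by
  rw [← f.intervalIntegral_comp_comm hw]
  simp

theorem apply_integral_sign {Z : ℝ → E} (hZ : Continuous Z) (f : E →L[ℝ] ℝ) (t : ℝ) :
    f (∫ s in (0 : ℝ)..t, (f (Z s) / |f (Z s)|) • Z s) = ∫ s in (0 : ℝ)..t, |f (Z s)| := by
  have hfZ : Continuous fun s => f (Z s) := f.continuous.comp hZ
  rw [apply_integral_weight f (intervalIntegrable_sign_smul hZ hfZ 0 t)]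
  simp only [div_abs_mul_self]

theorem apply_le_of_mem_momentSet {Z : ℝ → E} (hZ : Continuous Z) {t : ℝ} (ht : 0 ≤ t)
    (f : E →L[ℝ] ℝ) {a : E} (ha : a ∈ momentSet Z t) :
    f a ≤ ∫ s in (0 : ℝ)..t, |f (Z s)| := by
  obtain ⟨w, hw, hw1, rfl⟩ := ha
  rw [apply_integral_weight f (intervalIntegrable_smul_of_continuous hZ hw 0 t)]
  have hfZ : Continuous fun s => f (Z s) := f.continuous.comp hZ
  refine intervalIntegral.integral_mono_on ht ((hw.mul hfZ).intervalIntegrable _ _)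
    (hfZ.abs.intervalIntegrable _ _) fun s _ => ?_
  refine (le_abs_self _).trans ?_
  rw [abs_mul]
  exact mul_le_of_le_one_left (abs_nonneg _) (hw1 s)

theorem integral_sign_mem_frontier {Z : ℝ → E} (hZ : Continuous Z) {t : ℝ} (ht : 0 ≤ t)
    {f : E →L[ℝ] ℝ} (hf : f ≠ 0) :
    ∫ s in (0 : ℝ)..t, (f (Z s) / |f (Z s)|) • Z s ∈ frontier (momentSet Z t) := by
  refine ⟨integral_sign_mem_closure hZ ht (f.continuous.comp hZ), fun hinter => ?_⟩
  set y := ∫ s in (0 : ℝ)..t, (f (Z s) / |f (Z s)|) • Z s with hy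
  obtain ⟨e, he⟩ : ∃ e, 0 < f e := by
    obtain ⟨e, he⟩ : ∃ e, f e ≠ 0 := by
      by_contra! h
      exact hf (ContinuousLinearMap.ext h)
    rcases lt_or_gt_of_ne he with h | h
    · exact ⟨-e, by simpa using h⟩
    · exact ⟨e, h⟩
  have hcont : Tendsto (fun r : ℝ => y + r • e) (𝓝[>] 0) (𝓝 y) := by
    have : Continuous fun r : ℝ => y + r • e := by fun_prop
    have h0 := this.tendsto 0
    simp only [zero_smul, add_zero] at h0
    exact h0.mono_left nhdsWithin_le_nhds
  obtain ⟨r, hr, hr0⟩ :=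
    ((hcont.eventually (mem_interior_iff_mem_nhds.1 hinter)).and self_mem_nhdsWithin).exists
  have hle := apply_le_of_mem_momentSet hZ ht f hr
  rw [← apply_integral_sign hZ f t, ← hy, map_add, map_smul, smul_eq_mul] at hle
  have := mul_pos hr0 he
  linarith

theorem eq_integral_sign_of_support {Z : ℝ → E} (hZ : Continuous Z) {t : ℝ} (ht : 0 ≤ t)
    {f : E →L[ℝ] ℝ} (hfZ : ∀ᵐ s ∂(volume.restrict (Ioc 0 t)), f (Z s) ≠ 0) {y : E}
    (hy : y ∈ closure (momentSet Z t)) (hmax : ∀ a ∈ momentSet Z t, f a ≤ f y) :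
    y = ∫ s in (0 : ℝ)..t, (f (Z s) / |f (Z s)|) • Z s := by
  have hcfZ : Continuous fun s => f (Z s) := f.continuous.comp hZ
  obtain ⟨a, haK, hay⟩ := mem_closure_iff_seq_limit.1 hy
  choose w hw hw1 haw using haK
  have hge : ∫ s in (0 : ℝ)..t, |f (Z s)| ≤ f y := by
    rw [← apply_integral_sign hZ f t]
    exact closure_minimal (fun x hx => hmax x hx) (isClosed_le f.continuous continuous_const)
      (integral_sign_mem_closure hZ ht hcfZ)
  have hle : f y ≤ ∫ s in (0 : ℝ)..t, |f (Z s)| :=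
    closure_minimal (fun x hx => apply_le_of_mem_momentSet hZ ht f hx)
      (isClosed_le f.continuous continuous_const) hy
  have heq : f y = ∫ s in (0 : ℝ)..t, |f (Z s)| := le_antisymm hle hge
  set d : ℕ → ℝ → ℝ := fun k s => |f (Z s)| - w k s * f (Z s) with hd
  have hdc : ∀ k, Continuous (d k) := fun k => hcfZ.abs.sub ((hw k).mul hcfZ)
  have hd0 : ∀ k s, 0 ≤ d k s := fun k s => by
    have : w k s * f (Z s) ≤ |f (Z s)| := by
      refine (le_abs_self _).trans ?_
      rw [abs_mul]
      exact mul_le_of_le_one_left (abs_nonneg _) (hw1 k s)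
    simpa [hd] using this
  have hdint : Tendsto (fun k => ∫ s in Ioc 0 t, d k s) atTop (𝓝 0) := by
    have hi : ∀ k, IntervalIntegrable (fun s => w k s * f (Z s)) volume 0 t := fun k =>
      ((hw k).mul hcfZ).intervalIntegrable _ _
    have h1 : ∀ k, ∫ s in Ioc 0 t, d k s = f y - f (a k) := fun k => by
      rw [← intervalIntegral.integral_of_le ht, heq, haw k,
        apply_integral_weight f (intervalIntegrable_smul_of_continuous hZ (hw k) 0 t),
        ← intervalIntegral.integral_sub (hcfZ.abs.intervalIntegrable _ _) (hi k)]
    simp only [h1]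
    have := ((f.continuous.tendsto y).comp hay).const_sub (f y)
    simpa using this
  have hmeas : TendstoInMeasure (volume.restrict (Ioc 0 t)) d atTop (fun _ => (0 : ℝ)) := by
    refine tendstoInMeasure_of_tendsto_eLpNorm one_ne_zero
      (fun k => (hdc k).aestronglyMeasurable) aestronglyMeasurable_const ?_
    have h2 : ∀ k, eLpNorm (d k - fun _ => (0 : ℝ)) 1 (volume.restrict (Ioc 0 t)) =
        ENNReal.ofReal (∫ s in Ioc 0 t, d k s) := fun k => by
      have hi : Integrable (d k) (volume.restrict (Ioc 0 t)) :=
        ((hdc k).intervalIntegrable 0 t).1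
      rw [eLpNorm_one_eq_lintegral_enorm, ofReal_integral_eq_lintegral_ofReal hi
        (ae_of_all _ (hd0 k))]
      refine lintegral_congr fun s => ?_
      simp only [Pi.sub_apply, sub_zero]
      rw [Real.enorm_eq_ofReal (hd0 k s)]
    simp only [h2]
    simpa using ENNReal.tendsto_ofReal hdint
  obtain ⟨φ, hφ, hlim⟩ := hmeas.exists_seq_tendsto_ae
  have hwlim : ∀ᵐ s ∂(volume.restrict (Ioc 0 t)),
      Tendsto (fun k => w (φ k) s) atTop (𝓝 (f (Z s) / |f (Z s)|)) := by
    filter_upwards [hlim, hfZ] with s hs hne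
    have h3 : ∀ k, w (φ k) s = (|f (Z s)| - d (φ k) s) / f (Z s) := fun k => by
      rw [eq_div_iff hne]
      simp [hd]
    simp only [h3]
    have h4 : f (Z s) / |f (Z s)| = (|f (Z s)| - 0) / f (Z s) := by
      rw [sub_zero, div_eq_div_iff (abs_ne_zero.2 hne) hne, abs_mul_abs_self]
    rw [h4]
    exact (hs.const_sub _).div_const _
  have h5 := tendsto_integral_weight hZ ht (fun k => hw (φ k)) (fun k => hw1 (φ k)) hwlim
  have h6 : Tendsto (fun k => a (φ k)) atTop (𝓝 y) := hay.comp hφ.tendsto_atTop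
  simp only [haw] at h6
  exact tendsto_nhds_unique h6 h5

/-- The frontier of the moment set consists of the integrals against the signs of the nonzero
functionals. -/
theorem frontier_momentSet [FiniteDimensional ℝ E] {Z : ℝ → E} (hZ : Continuous Z) {t : ℝ}
    (ht : 0 ≤ t)
    (hne : ∀ f : E →L[ℝ] ℝ, f ≠ 0 → ∀ᵐ s ∂(volume.restrict (Ioc 0 t)), f (Z s) ≠ 0) :
    frontier (momentSet Z t) =
      {y | ∃ f : E →L[ℝ] ℝ, f ≠ 0 ∧
        y = ∫ s in (0 : ℝ)..t, (f (Z s) / |f (Z s)|) • Z s} := by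
  ext y
  constructor
  · intro hy
    obtain ⟨f, hf, hmax⟩ := exists_support_of_mem_frontier (convex_momentSet hZ t) hy
    exact ⟨f, hf, eq_integral_sign_of_support hZ ht (hne f hf) hy.1 hmax⟩
  · rintro ⟨f, hf, rfl⟩
    exact integral_sign_mem_frontier hZ ht hf

end Moment

section SignPattern

open Polynomial

theorem exists_sign_of_no_root {R : ℝ[X]} {t : ℝ} (hroot : ∀ r ∈ Icc 0 t, R.eval r ≠ 0) :
    ∃ ε : ℝ, (ε = 1 ∨ ε = -1) ∧ ∀ r ∈ Icc 0 t, 0 ≤ ε * R.eval r := by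
  by_cases hpos : ∀ r ∈ Icc 0 t, 0 ≤ R.eval r
  · exact ⟨1, Or.inl rfl, fun r hr => by simpa using hpos r hr⟩
  · push Not at hpos
    obtain ⟨r₀, hr₀, hneg⟩ := hpos
    refine ⟨-1, Or.inr rfl, fun r hr => ?_⟩
    by_contra! hcon
    have hp : 0 < R.eval r := by linarith
    obtain ⟨c, hc, hc0⟩ := isPreconnected_Icc.intermediate_value hr₀ hr
      R.continuous.continuousOn ⟨hneg.le, hp.le⟩
    exact hroot c hc hc0

/-- On `[0, t]`, a nonzero polynomial of degree at most `m` has, up to a global sign, the sign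
pattern of a product of `m` linear factors with roots in `[0, t]`. -/
theorem exists_sign_pattern {t : ℝ} (ht : 0 ≤ t) (m : ℕ) :
    ∀ R : ℝ[X], R ≠ 0 → R.natDegree ≤ m →
      ∃ ρ : Fin m → ℝ, (∀ i, ρ i ∈ Icc 0 t) ∧ ∃ ε : ℝ, (ε = 1 ∨ ε = -1) ∧
        ∀ r ∈ Icc 0 t, 0 ≤ ε * (R.eval r * ∏ i, (r - ρ i)) := by
  induction m with
  | zero =>
    intro R hR hdeg
    have hRC := eq_C_of_natDegree_le_zero hdeg
    obtain ⟨ε, hε, h⟩ := exists_sign_of_no_root (R := R) (t := t) fun r _ h0 => hR <| by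
      rw [hRC, eval_C] at h0
      rw [hRC, h0, C_0]
    exact ⟨Fin.elim0, fun i => i.elim0, ε, hε, fun r hr => by simpa using h r hr⟩
  | succ m ih =>
    intro R hR hdeg
    by_cases hroot : ∀ r ∈ Icc 0 t, R.eval r ≠ 0
    · obtain ⟨ε, hε, h⟩ := exists_sign_of_no_root hroot
      refine ⟨fun _ => 0, fun _ => ⟨le_rfl, ht⟩, ε, hε, fun r hr => ?_⟩
      rw [← mul_assoc]
      exact mul_nonneg (h r hr) (Finset.prod_nonneg fun _ _ => by simpa using hr.1)
    · push Not at hroot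
      obtain ⟨x, hx, hx0⟩ := hroot
      obtain ⟨Q, rfl⟩ := dvd_iff_isRoot.2 (show IsRoot R x from hx0)
      have hQ : Q ≠ 0 := right_ne_zero_of_mul hR
      rw [natDegree_mul (X_sub_C_ne_zero x) hQ, natDegree_X_sub_C] at hdeg
      obtain ⟨ρ, hρ, ε, hε, h⟩ := ih Q hQ (by omega)
      refine ⟨Fin.cons x ρ, fun i => ?_, ε, hε, fun r hr => ?_⟩
      · refine Fin.cases hx (fun j => ?_) i
        simpa using hρ j
      · have h1 := mul_nonneg (h r hr) (sq_nonneg (r - x))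
        rw [Fin.prod_univ_succ]
        simp only [Fin.cons_zero, Fin.cons_succ, eval_mul, eval_sub, eval_X, eval_C]
        calc (0 : ℝ) ≤ ε * (Q.eval r * ∏ i, (r - ρ i)) * (r - x) ^ 2 := h1
          _ = _ := by ring

variable {m : ℕ}

/-- A functional on `ℝⁿ` evaluated along `ξ` is a polynomial of degree at most `n - 1`. -/
theorem exists_poly_of_functional {f : (Fin (m + 1) → ℝ) →L[ℝ] ℝ} (hf : f ≠ 0) :
    ∃ R : ℝ[X], R ≠ 0 ∧ R.natDegree ≤ m ∧ ∀ r, f (xi m r) = R.eval r := by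
  set c : Fin (m + 1) → ℝ := fun k => f (fun j => if k = j then 1 else 0) with hc
  have hfc : ∀ x, f x = ∑ k, x k * c k := fun x => by
    simpa using LinearMap.pi_apply_eq_sum_univ (f : (Fin (m + 1) → ℝ) →ₗ[ℝ] ℝ) x
  obtain ⟨j, hj⟩ : ∃ j, c j ≠ 0 := by
    by_contra! h
    exact hf (ContinuousLinearMap.ext fun x => by simp [hfc, h])
  refine ⟨∑ k : Fin (m + 1), C (c k / (m - (k : ℕ)).factorial) * X ^ (m - (k : ℕ)),
    fun h0 => hj ?_, ?_, fun r => ?_⟩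
  · have h1 := congrArg (fun P : ℝ[X] => P.coeff (m - (j : ℕ))) h0
    simp only [finsetSum_coeff, coeff_C_mul_X_pow, coeff_zero] at h1
    rw [Finset.sum_eq_single j] at h1
    · simp only [if_true] at h1
      have h2 : ((m - (j : ℕ)).factorial : ℝ) ≠ 0 := by positivity
      simpa [h2] using h1
    · intro k _ hk
      rw [if_neg]
      intro h
      apply hk
      ext
      omega
    · simp
  · refine natDegree_sum_le_of_forall_le _ _ fun k _ => ?_
    exact (natDegree_C_mul_X_pow_le _ _).trans (Nat.sub_le _ _)
  · rw [hfc, eval_finsetSum]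
    refine Finset.sum_congr rfl fun k _ => ?_
    simp only [xi, eval_mul, eval_C, eval_pow, eval_X]
    ring

theorem exists_functional_of_poly {R : ℝ[X]} (hR : R ≠ 0) (hdeg : R.natDegree ≤ m) :
    ∃ f : (Fin (m + 1) → ℝ) →L[ℝ] ℝ, f ≠ 0 ∧ ∀ r, f (xi m r) = R.eval r := by
  set f : (Fin (m + 1) → ℝ) →L[ℝ] ℝ := ∑ k : Fin (m + 1),
    (R.coeff (m - (k : ℕ)) * (m - (k : ℕ)).factorial) •
      ContinuousLinearMap.proj (R := ℝ) (φ := fun _ : Fin (m + 1) => ℝ) k with hf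
  have hfR : ∀ r, f (xi m r) = R.eval r := fun r => by
    rw [eval_eq_sum_range' (Nat.lt_succ_of_le hdeg), ← Finset.sum_range_reflect,
      ← Fin.sum_univ_eq_sum_range (fun j => R.coeff (m.succ - 1 - j) * r ^ (m.succ - 1 - j)), hf]
    simp only [sum_apply, smul_apply,
      ContinuousLinearMap.proj_apply, smul_eq_mul, xi]
    refine Finset.sum_congr rfl fun k _ => ?_
    have h2 : ((m - (k : ℕ)).factorial : ℝ) ≠ 0 := by positivity
    simp only [Nat.succ_sub_one]
    field_simp
  refine ⟨f, fun h0 => hR (Polynomial.funext fun r => ?_), hfR⟩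
  rw [← hfR, h0]
  simp

end SignPattern

section Alternating

variable {m : ℕ}

theorem continuous_xi (m : ℕ) : Continuous (xi m) := by
  unfold xi
  fun_prop

theorem nodes_castSucc_succ (t : ℝ) (σ : Fin m → ℝ) (j : Fin m) :
    nodes t σ j.succ.castSucc = σ j := by
  rw [← Fin.succ_castSucc]
  simp only [nodes, Fin.cons_succ, Fin.snoc_castSucc]

theorem nodes_succ_castSucc (t : ℝ) (σ : Fin m → ℝ) (j : Fin m) :
    nodes t σ j.castSucc.succ = σ j := by
  simp only [nodes, Fin.cons_succ, Fin.snoc_castSucc]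

theorem nodes_succ_last (t : ℝ) (σ : Fin m → ℝ) : nodes t σ (Fin.last m).succ = t := by
  simp only [nodes, Fin.cons_succ, Fin.snoc_last]

theorem le_nodes_castSucc {t : ℝ} {σ : Fin m → ℝ} (hσ : Monotone σ) {k : Fin (m + 1)} {i : Fin m}
    (hik : (i : ℕ) < k) : σ i ≤ nodes t σ k.castSucc := by
  induction k using Fin.cases with
  | zero => simp at hik
  | succ j =>
    rw [nodes_castSucc_succ]
    exact hσ (Fin.le_def.2 (by simpa [Nat.lt_succ_iff] using hik))

theorem nodes_succ_le {t : ℝ} {σ : Fin m → ℝ} (hσ : Monotone σ) {k : Fin (m + 1)} {i : Fin m}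
    (hik : (k : ℕ) ≤ i) : nodes t σ k.succ ≤ σ i := by
  induction k using Fin.lastCases with
  | last => exact absurd i.isLt (not_lt.2 (by simpa using hik))
  | cast j =>
    rw [nodes_succ_castSucc]
    exact hσ (Fin.le_def.2 (by simpa using hik))

theorem nodes_le_nodes_succ {t : ℝ} (ht : 0 ≤ t) {σ : Fin m → ℝ} (hσ : σ ∈ weylChamber m t)
    (k : Fin (m + 1)) : nodes t σ k.castSucc ≤ nodes t σ k.succ := by
  induction k using Fin.lastCases with
  | last =>
    rw [nodes_succ_last]
    cases m with
    | zero => simpa [nodes] using ht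
    | succ m =>
      rw [← Fin.succ_last, nodes_castSucc_succ]
      exact (hσ.2 _).2
  | cast j =>
    rw [nodes_succ_castSucc]
    cases m with
    | zero => exact j.elim0
    | succ m =>
      induction j using Fin.cases with
      | zero => simpa [nodes] using (hσ.2 0).1
      | succ j =>
        rw [← Fin.succ_castSucc, nodes_castSucc_succ]
        exact hσ.1 (Fin.castSucc_le_succ j)

theorem prod_sign_eq_neg_one_pow {t : ℝ} {σ : Fin m → ℝ} (hσ : Monotone σ) {k : Fin (m + 1)}
    {s : ℝ} (hs : s ∈ Ioo (nodes t σ k.castSucc) (nodes t σ k.succ)) :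
    (∏ i, (σ i - s)) / |∏ i, (σ i - s)| = (-1) ^ (k : ℕ) := by
  rw [Finset.abs_prod, ← Finset.prod_div_distrib]
  have h : ∀ i : Fin m, (σ i - s) / |σ i - s| = if (i : ℕ) < k then -1 else 1 := fun i => by
    split_ifs with hik
    · have : σ i - s < 0 := sub_neg.2 ((le_nodes_castSucc hσ hik).trans_lt hs.1)
      rw [abs_of_neg this, div_neg, div_self this.ne]
    · have : 0 < σ i - s := sub_pos.2 (hs.2.trans_le (nodes_succ_le hσ (not_lt.1 hik)))
      rw [abs_of_pos this, div_self this.ne']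
  simp only [h]
  rw [Finset.prod_ite]
  simp only [Finset.prod_const, one_pow, mul_one]
  rw [Fin.card_filter_val_lt, min_eq_right (Nat.lt_succ_iff.1 k.isLt)]

/-- The alternating sum of integrals is the integral against the sign of `∏ (σ i - s)`. -/
theorem alternating_eq_integral_sign {t : ℝ} (ht : 0 ≤ t) {σ : Fin m → ℝ}
    (hσ : σ ∈ weylChamber m t) {μ : ℝ → ℝ} (hμ : Continuous μ) :
    alternating μ t σ = ∫ s in (0 : ℝ)..t,
      ((∏ i, (σ i - s)) / |∏ i, (σ i - s)|) • μ s • xi m (t - s) := by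
  have hZ : Continuous fun s => μ s • xi m (t - s) :=
    hμ.smul ((continuous_xi m).comp (continuous_const.sub continuous_id))
  have hh : Continuous fun s => ∏ i, (σ i - s) := by fun_prop
  set a : ℕ → ℝ := fun k => if h : k < m + 2 then nodes t σ ⟨k, h⟩ else t with ha
  have hk0 : ∀ k : Fin (m + 1), a k = nodes t σ k.castSucc := fun k => by
    simp only [ha]
    rw [dif_pos (by omega)]
    rfl
  have hk1 : ∀ k : Fin (m + 1), a (k + 1) = nodes t σ k.succ := fun k => by
    simp only [ha]
    rw [dif_pos (by omega)]
    rfl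
  have h0 : a 0 = 0 := by simpa [nodes] using hk0 0
  have ht1 : a (m + 1) = t := by simpa only [Fin.val_last, nodes_succ_last] using hk1 (Fin.last m)
  have hsum := intervalIntegral.sum_integral_adjacent_intervals (a := a) (n := m + 1)
    (f := fun s => ((∏ i, (σ i - s)) / |∏ i, (σ i - s)|) • μ s • xi m (t - s)) (μ := volume)
    fun k _ => intervalIntegrable_sign_smul hZ hh _ _
  rw [h0, ht1] at hsum
  rw [← hsum, ← Fin.sum_univ_eq_sum_range (fun k => ∫ s in a k..a (k + 1),
    ((∏ i, (σ i - s)) / |∏ i, (σ i - s)|) • μ s • xi m (t - s)), alternating]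
  refine Finset.sum_congr rfl fun k _ => ?_
  rw [hk0, hk1, ← intervalIntegral.integral_smul]
  refine intervalIntegral.integral_congr_ae ?_
  filter_upwards [compl_mem_ae_iff.2 (measure_singleton (nodes t σ k.succ))] with s hs hsI
  rw [uIoc_of_le (nodes_le_nodes_succ ht hσ k)] at hsI
  rw [prod_sign_eq_neg_one_pow hσ.1 ⟨hsI.1, lt_of_le_of_ne hsI.2 hs⟩]

end Alternating

section FrontierXi

open Polynomial

variable {m : ℕ}

theorem ae_eval_sub_ne_zero {R : ℝ[X]} (hR : R ≠ 0) (t : ℝ) : ∀ᵐ s : ℝ, R.eval (t - s) ≠ 0 := by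
  have hfin : {s : ℝ | R.eval (t - s) = 0}.Finite := by
    refine Set.Finite.preimage (f := fun s => t - s) (sub_right_injective.injOn)
      ((finite_setOfPred_isRoot hR))
  have := hfin.measure_zero volume
  rw [ae_iff]
  simpa using this

theorem div_abs_eq_of_mul_nonneg {ε x y : ℝ} (hε : ε = 1 ∨ ε = -1) (hx : x ≠ 0) (hy : y ≠ 0)
    (h : 0 ≤ ε * (x * y)) : x / |x| = ε * (y / |y|) := by
  rcases lt_or_gt_of_ne hx with hx' | hx' <;> rcases lt_or_gt_of_ne hy with hy' | hy' <;>
    rcases hε with rfl | rfl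
  · simp [abs_of_neg, hx', hy', div_neg, div_self hx, div_self hy]
  · nlinarith [mul_pos_of_neg_of_neg hx' hy']
  · nlinarith [mul_neg_of_neg_of_pos hx' hy']
  · simp [abs_of_neg, abs_of_pos, hx', hy', div_neg, div_self hx, div_self hy]
  · nlinarith [mul_neg_of_pos_of_neg hx' hy']
  · simp [abs_of_neg, abs_of_pos, hx', hy', div_neg, div_self hx, div_self hy]
  · simp [abs_of_pos, hx', hy', div_self hx, div_self hy]
  · nlinarith [mul_pos hx' hy']

theorem mul_div_abs_mul {a : ℝ} (ha : 0 < a) (x : ℝ) : a * x / |a * x| = x / |x| := by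
  rw [abs_mul, abs_of_pos ha, mul_div_mul_left _ _ ha.ne']

/-- The frontier of the moment set of `μ ξ(t - ·)`: bang-bang weights with at most `m`
switches. -/
theorem frontier_momentSet_xi {t : ℝ} (ht : 0 < t) {μ : ℝ → ℝ} (hμ : Continuous μ)
    (hpos : ∀ s ∈ Icc 0 t, 0 < μ s) :
    frontier (momentSet (fun s => μ s • xi m (t - s)) t) =
      alternating μ t '' weylChamber m t ∪
        (fun σ => -alternating μ t σ) '' weylChamber m t := by
  have hZ : Continuous fun s => μ s • xi m (t - s) :=
    hμ.smul ((continuous_xi m).comp (continuous_const.sub continuous_id))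
  have hsign : ∀ (f : (Fin (m + 1) → ℝ) →L[ℝ] ℝ), ∀ s ∈ Ioc 0 t,
      f (μ s • xi m (t - s)) / |f (μ s • xi m (t - s))| =
        f (xi m (t - s)) / |f (xi m (t - s))| := fun f s hs => by
    rw [map_smul, smul_eq_mul, mul_div_abs_mul (hpos s ⟨hs.1.le, hs.2⟩)]
  rw [frontier_momentSet hZ ht.le]
  · ext y
    constructor
    · rintro ⟨f, hf, rfl⟩
      obtain ⟨R, hR, hdeg, hfR⟩ := exists_poly_of_functional hf
      obtain ⟨ρ, hρ, ε, hε, h⟩ := exists_sign_pattern ht.le m R hR hdeg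
      set σ₀ : Fin m → ℝ := fun i => t - ρ i with hσ₀
      set σ : Fin m → ℝ := σ₀ ∘ Tuple.sort σ₀ with hσdef
      have hσ : σ ∈ weylChamber m t := by
        refine ⟨Tuple.monotone_sort σ₀, fun i => ?_⟩
        have := hρ (Tuple.sort σ₀ i)
        exact ⟨sub_nonneg.2 this.2, sub_le_self _ this.1⟩
      have hprod : ∀ s, ∏ i, (σ i - s) = ∏ i, (t - s - ρ i) := fun s => by
        rw [hσdef, ← Equiv.prod_comp (Tuple.sort σ₀) fun i => t - s - ρ i]
        refine Finset.prod_congr rfl fun i _ => ?_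
        simp only [Function.comp_apply, hσ₀]
        ring
      have hP : (∏ i, (X - C (ρ i)) : ℝ[X]) ≠ 0 :=
        Finset.prod_ne_zero_iff.2 fun i _ => X_sub_C_ne_zero _
      have hkey : ∫ s in (0 : ℝ)..t, (f (μ s • xi m (t - s)) / |f (μ s • xi m (t - s))|) •
          μ s • xi m (t - s) = ε • alternating μ t σ := by
        rw [alternating_eq_integral_sign ht.le hσ hμ, ← intervalIntegral.integral_smul]
        refine intervalIntegral.integral_congr_ae ?_
        filter_upwards [ae_eval_sub_ne_zero hR t, ae_eval_sub_ne_zero hP t] with s h1 h2 hs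
        rw [uIoc_of_le ht.le] at hs
        simp only [eval_prod, eval_sub, eval_X, eval_C] at h2
        rw [hsign f s hs, hfR, hprod,
          div_abs_eq_of_mul_nonneg hε h1 h2 (h _ ⟨sub_nonneg.2 hs.2, sub_le_self _ hs.1.le⟩),
          mul_smul]
      rw [hkey]
      rcases hε with rfl | rfl
      · exact Or.inl ⟨σ, hσ, by simp⟩
      · exact Or.inr ⟨σ, hσ, by simp⟩
    · have hmain : ∀ σ ∈ weylChamber m t, ∃ f : (Fin (m + 1) → ℝ) →L[ℝ] ℝ, f ≠ 0 ∧
          alternating μ t σ = ∫ s in (0 : ℝ)..t,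
            (f (μ s • xi m (t - s)) / |f (μ s • xi m (t - s))|) • μ s • xi m (t - s) := by
        intro σ hσ
        have hP : (∏ i, (X - C (t - σ i)) : ℝ[X]) ≠ 0 :=
          Finset.prod_ne_zero_iff.2 fun i _ => X_sub_C_ne_zero _
        obtain ⟨f, hf, hfR⟩ := exists_functional_of_poly (m := m) hP
          (by simp [natDegree_prod_of_monic _ _ fun i _ => monic_X_sub_C (t - σ i), -map_sub])
        refine ⟨f, hf, ?_⟩
        rw [alternating_eq_integral_sign ht.le hσ hμ]
        refine intervalIntegral.integral_congr_ae (ae_of_all _ fun s hs => ?_)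
        rw [uIoc_of_le ht.le] at hs
        rw [hsign f s hs, hfR]
        simp only [eval_prod, eval_sub, eval_X, eval_C, sub_sub_sub_cancel_left]
      rintro (⟨σ, hσ, rfl⟩ | ⟨σ, hσ, rfl⟩)
      · exact hmain σ hσ
      · obtain ⟨f, hf, h⟩ := hmain σ hσ
        refine ⟨-f, neg_ne_zero.2 hf, ?_⟩
        simp only [h, neg_apply, abs_neg, neg_div, neg_smul]
        rw [intervalIntegral.integral_neg]
  · intro f hf
    obtain ⟨R, hR, -, hfR⟩ := exists_poly_of_functional hf
    rw [ae_restrict_iff' measurableSet_Ioc]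
    filter_upwards [ae_eval_sub_ne_zero hR t] with s hs hst
    rw [map_smul, smul_eq_mul, hfR]
    exact mul_ne_zero (hpos s ⟨hst.1.le, hst.2⟩).ne' hs

end FrontierXi

section Integrator

variable {m : ℕ}

theorem exists_linear_ode_solution (F : Matrix (Fin (m + 1)) (Fin (m + 1)) ℝ)
    (g x₀ : Fin (m + 1) → ℝ) {t : ℝ} (ht : 0 ≤ t) {u : ℝ → ℝ} (hu : ContinuousOn u (Icc 0 t)) :
    ∃ x : ℝ → Fin (m + 1) → ℝ, x 0 = x₀ ∧
      ∀ s ∈ Icc 0 t, HasDerivWithinAt x (F *ᵥ x s + u s • g) (Icc 0 t) s := by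
  set L : (Fin (m + 1) → ℝ) →L[ℝ] (Fin (m + 1) → ℝ) := F.mulVecLin.toContinuousLinearMap with hL
  have hz : ∀ s : ℝ, s • L + (-s) • L = 0 := fun s => by
    ext x i
    simp [-neg_smul]
  let _ : NormedAlgebra ℚ ((Fin (m + 1) → ℝ) →L[ℝ] (Fin (m + 1) → ℝ)) :=
    NormedAlgebra.restrictScalars ℚ ℝ _
  set v : ℝ → ℝ := IccExtend ht ((Icc 0 t).domRestrict u) with hv
  have hvc : Continuous v := hu.domRestrict.Icc_extend'
  have hexp : Continuous fun r : ℝ => NormedSpace.exp (r • L) :=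
    continuous_iff_continuousAt.2 fun r => (hasDerivAt_exp_smul_const' L r).continuousAt
  have hφ : Continuous fun r : ℝ => v r • NormedSpace.exp ((-r) • L) g :=
    hvc.smul ((hexp.comp continuous_neg).clm_apply continuous_const)
  set G : ℝ → Fin (m + 1) → ℝ := fun s => ∫ r in (0 : ℝ)..s, v r • NormedSpace.exp ((-r) • L) g
    with hG
  refine ⟨fun s => NormedSpace.exp (s • L) (x₀ + G s), ?_, fun s hs => ?_⟩
  · simp [hG]
  · have h1 : HasDerivAt (fun s => x₀ + G s) (v s • NormedSpace.exp ((-s) • L) g) s :=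
      (intervalIntegral.integral_hasDerivAt_right (hφ.intervalIntegrable _ _)
        (hφ.stronglyMeasurableAtFilter _ _) hφ.continuousAt).const_add x₀
    have h2 := (hasDerivAt_exp_smul_const' L s).clm_apply h1
    have hinv : NormedSpace.exp (s • L) (NormedSpace.exp ((-s) • L) g) = g := by
      have hcomm : Commute (s • L) ((-s) • L) := ((Commute.refl L).smul_left s).smul_right (-s)
      have hmul : NormedSpace.exp (s • L) * NormedSpace.exp ((-s) • L) = 1 := by
        rw [← NormedSpace.exp_add_of_commute hcomm, hz, NormedSpace.exp_zero]
      exact congrArg (fun T : (Fin (m + 1) → ℝ) →L[ℝ] (Fin (m + 1) → ℝ) => T g) hmul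
    have hvs : v s = u s := by
      rw [hv, IccExtend_of_mem ht _ hs]
      rfl
    rw [map_smul, hinv, hvs] at h2
    exact h2.hasDerivWithinAt

theorem Aint_mulVec (x : Fin (m + 1) → ℝ) (l : Fin (m + 1)) :
    (Aint m *ᵥ x) l = if h : (l : ℕ) + 1 < m + 1 then x ⟨l + 1, h⟩ else 0 := by
  simp only [Matrix.mulVec, dotProduct, Aint, Matrix.of_apply, ite_mul, one_mul, zero_mul]
  split_ifs with h
  · rw [Finset.sum_eq_single ⟨l + 1, h⟩]
    · simp
    · intro j _ hj
      rw [if_neg]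
      intro hj'
      exact hj (Fin.ext hj')
    · simp
  · exact Finset.sum_eq_zero fun j _ => if_neg (by omega)

theorem hasDerivAt_pow_div_factorial (t : ℝ) (j : ℕ) (s : ℝ) :
    HasDerivAt (fun s : ℝ => (t - s) ^ j / (j.factorial : ℝ))
      (if 0 < j then -((t - s) ^ (j - 1) / ((j - 1).factorial : ℝ)) else 0) s := by
  have h := ((((hasDerivAt_id s).const_sub t).pow j).div_const (j.factorial : ℝ))
  refine h.congr_deriv ?_
  cases j with
  | zero => simp
  | succ j =>
    have h1 : ((j.factorial : ℕ) : ℝ) ≠ 0 := by positivity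
    have h2 : (j : ℝ) + 1 ≠ 0 := by positivity
    simp only [Nat.factorial_succ, Nat.add_sub_cancel, Nat.succ_pos, if_true, id]
    push_cast
    field_simp

/-- Along a solution of the integrator, the propagated state `χ(t - s, x(s))` has derivative
`u(s) ξ(t - s)`. -/
theorem hasDerivWithinAt_chi {t s : ℝ} {S : Set ℝ} {x : ℝ → Fin (m + 1) → ℝ} {u : ℝ}
    (hx : HasDerivWithinAt x
      (Aint m *ᵥ x s + u • (Pi.single (Fin.last m) 1 : Fin (m + 1) → ℝ)) S s) :
    HasDerivWithinAt (fun s => chi (t - s) (x s)) (u • xi m (t - s)) S s := by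
  rw [hasDerivWithinAt_pi] at hx ⊢
  intro k
  set p : ℕ → ℝ := fun j => (t - s) ^ j / (j.factorial : ℝ) with hp
  have hterm : ∀ l : Fin (m + 1), HasDerivWithinAt
      (fun s => if k ≤ l then (t - s) ^ ((l : ℕ) - (k : ℕ)) /
        (((l : ℕ) - (k : ℕ)).factorial : ℝ) * x s l else 0)
      (if k ≤ l then (if 0 < (l : ℕ) - k then -p (l - k - 1) else 0) * x s l +
        p (l - k) * ((Aint m *ᵥ x s) l + u * (Pi.single (Fin.last m) 1 : Fin (m + 1) → ℝ) l)
        else 0) S s := fun l => by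
    by_cases hkl : k ≤ l
    · simp only [if_pos hkl]
      exact (hasDerivAt_pow_div_factorial t _ s).hasDerivWithinAt.mul (hx l)
    · simp only [if_neg hkl]
      exact hasDerivWithinAt_const _ _ _
  have hsum := HasDerivWithinAt.fun_sum (u := Finset.univ) fun l _ => hterm l
  refine hsum.congr_deriv ?_
  set T : ℕ → ℝ := fun l => if (k : ℕ) < l then
    p (l - k - 1) * (if h : l < m + 1 then x s ⟨l, h⟩ else 0) else 0 with hT
  have hl : ∀ l : Fin (m + 1), (if k ≤ l then (if 0 < (l : ℕ) - k then -p (l - k - 1) else 0) *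
        x s l + p (l - k) * ((Aint m *ᵥ x s) l +
          u * (Pi.single (Fin.last m) 1 : Fin (m + 1) → ℝ) l) else 0) =
      (T (l + 1) - T l) + if l = Fin.last m then u * p (m - k) else 0 := fun l => by
    rw [Aint_mulVec]
    by_cases hkl : k ≤ l
    · have hkl' : (k : ℕ) ≤ l := hkl
      have h1 : (l : ℕ) + 1 - k - 1 = l - k := by omega
      have h2 : (k : ℕ) < l + 1 := by omega
      have h3 : (0 < (l : ℕ) - k) ↔ (k : ℕ) < l := by omega
      simp only [if_pos hkl, hT, h1, if_pos h2, h3, dif_pos l.isLt, Fin.eta]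
      by_cases hlm : l = Fin.last m
      · subst hlm
        simp only [Pi.single_eq_same, if_true, Fin.val_last]
        split_ifs <;> ring
      · simp only [Pi.single_eq_of_ne hlm, if_neg hlm]
        split_ifs <;> ring
    · have hkl' : ¬ (k : ℕ) ≤ l := hkl
      have h2 : ¬ (k : ℕ) < l + 1 := by omega
      have h3 : ¬ (k : ℕ) < l := by omega
      have h4 : l ≠ Fin.last m := by
        rintro rfl
        exact hkl (Fin.le_last k)
      simp [if_neg hkl, hT, h2, h3, h4]
  rw [Finset.sum_congr rfl fun l _ => hl l, Finset.sum_add_distrib,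
    Fin.sum_univ_eq_sum_range (fun l => T (l + 1) - T l) (m + 1), Finset.sum_range_sub,
    Finset.sum_ite_eq' Finset.univ (Fin.last m)]
  simp [hT, hp, xi]

theorem chi_zero (x : Fin (m + 1) → ℝ) : chi 0 x = x := by
  ext k
  simp only [chi]
  rw [Finset.sum_eq_single k]
  · simp
  · intro l _ hl
    split_ifs with h
    · have : (l : ℕ) - k ≠ 0 := by
        have h1 : (k : ℕ) ≤ l := h
        have h2 : (l : ℕ) ≠ k := fun h' => hl (Fin.ext h')
        omega
      simp [this]
    · rfl
  · simp

theorem integrator_solution_eq {t : ℝ} (ht : 0 ≤ t) {u : ℝ → ℝ} (hu : ContinuousOn u (Icc 0 t))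
    {x : ℝ → Fin (m + 1) → ℝ}
    (hx : ∀ s ∈ Icc 0 t, HasDerivWithinAt x
      (Aint m *ᵥ x s + u s • (Pi.single (Fin.last m) 1 : Fin (m + 1) → ℝ)) (Icc 0 t) s) :
    x t = chi t (x 0) + ∫ s in (0 : ℝ)..t, u s • xi m (t - s) := by
  have hd : ∀ s ∈ Icc 0 t, HasDerivWithinAt (fun s => chi (t - s) (x s)) (u s • xi m (t - s))
      (Icc 0 t) s := fun s hs => hasDerivWithinAt_chi (hx s hs)
  have hinter : IntervalIntegrable (fun s => u s • xi m (t - s)) volume 0 t := by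
    refine ContinuousOn.intervalIntegrable ?_
    rw [uIcc_of_le ht]
    exact hu.smul ((continuous_xi m).comp (continuous_const.sub continuous_id)).continuousOn
  rw [intervalIntegral.integral_eq_sub_of_hasDerivAt_of_le ht
    (fun s hs => (hd s hs).continuousWithinAt)
    (fun s hs => (hd s (Ioo_subset_Icc_self hs)).hasDerivAt (Icc_mem_nhds hs.1 hs.2)) hinter]
  simp [chi_zero]

/-- The reach set of the integrator consists of the integrals of the admissible inputs against
`ξ(t - ·)`, translated by the free response. -/
theorem reachSet_integrator {t : ℝ} (ht : 0 ≤ t) (lo hi : ℝ → ℝ) (x₀ : Fin (m + 1) → ℝ) :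
    reachSet (Aint m) (Pi.single (Fin.last m) 1) lo hi t x₀ =
      {y | ∃ u : ℝ → ℝ, ContinuousOn u (Icc 0 t) ∧ (∀ s ∈ Icc 0 t, u s ∈ Icc (lo s) (hi s)) ∧
        y = chi t x₀ + ∫ s in (0 : ℝ)..t, u s • xi m (t - s)} := by
  ext y
  constructor
  · rintro ⟨u, x, hu, hb, hx0, hx, rfl⟩
    exact ⟨u, hu, hb, by rw [integrator_solution_eq ht hu hx, hx0]⟩
  · rintro ⟨u, hu, hb, rfl⟩
    obtain ⟨x, hx0, hx⟩ := exists_linear_ode_solution (Aint m) (Pi.single (Fin.last m) 1) x₀ ht hu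
    exact ⟨u, x, hu, hb, hx0, hx, by rw [integrator_solution_eq ht hu hx, hx0]⟩

theorem reachSet_eq_translate {t : ℝ} (ht : 0 ≤ t) {lo hi : ℝ → ℝ} (hlo : Continuous lo)
    (hhi : Continuous hi) (hlt : ∀ s ∈ Icc 0 t, lo s < hi s) (x₀ : Fin (m + 1) → ℝ) :
    reachSet (Aint m) (Pi.single (Fin.last m) 1) lo hi t x₀ =
      (fun y => (chi t x₀ + ∫ s in (0 : ℝ)..t, midpt lo hi s • xi m (t - s)) + y) ''
        momentSet (fun s => halfWidth lo hi s • xi m (t - s)) t := by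
  have hξ : Continuous fun s => xi m (t - s) :=
    (continuous_xi m).comp (continuous_const.sub continuous_id)
  have hμ : Continuous (halfWidth lo hi) := (hhi.sub hlo).div_const 2
  have hν : Continuous (midpt lo hi) := (hhi.add hlo).div_const 2
  have hpos : ∀ s ∈ Icc 0 t, 0 < halfWidth lo hi s := fun s hs =>
    half_pos (sub_pos.2 (hlt s hs))
  have hsplit : ∀ w : ℝ → ℝ, Continuous w →
      ∫ s in (0 : ℝ)..t, (midpt lo hi s + halfWidth lo hi s * w s) • xi m (t - s) =
        (∫ s in (0 : ℝ)..t, midpt lo hi s • xi m (t - s)) +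
          ∫ s in (0 : ℝ)..t, w s • halfWidth lo hi s • xi m (t - s) := fun w hw => by
    have h1 : IntervalIntegrable (fun s => midpt lo hi s • xi m (t - s)) volume 0 t :=
      (hν.smul hξ).intervalIntegrable _ _
    have h2 : IntervalIntegrable (fun s => w s • halfWidth lo hi s • xi m (t - s)) volume 0 t :=
      (hw.smul (hμ.smul hξ)).intervalIntegrable _ _
    rw [← intervalIntegral.integral_add h1 h2]
    refine intervalIntegral.integral_congr fun s _ => ?_
    simp only [add_smul, smul_smul, mul_comm (w s)]
  rw [reachSet_integrator ht]
  ext y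
  constructor
  · rintro ⟨u, hu, hb, rfl⟩
    have hq : ContinuousOn (fun s => (u s - midpt lo hi s) / halfWidth lo hi s) (Icc 0 t) :=
      (hu.sub hν.continuousOn).div hμ.continuousOn fun s hs => (hpos s hs).ne'
    set w : ℝ → ℝ := IccExtend ht ((Icc 0 t).domRestrict
      fun s => (u s - midpt lo hi s) / halfWidth lo hi s) with hw
    have hwc : Continuous w := hq.domRestrict.Icc_extend'
    refine ⟨_, ⟨w, hwc, fun s => ?_, rfl⟩, ?_⟩
    · simp only [hw, IccExtend, Function.comp_apply, domRestrict_apply]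
      set r := projIcc 0 t ht s
      change |(u r - midpt lo hi r) / halfWidth lo hi r| ≤ 1
      have h1 := hpos r r.2
      have h2 := hb r r.2
      rw [abs_div, abs_of_pos h1, div_le_one h1, abs_le]
      simp only [midpt, halfWidth]
      constructor <;> linarith [h2.1, h2.2]
    · simp only
      rw [add_assoc, ← hsplit w hwc]
      congr 1
      refine intervalIntegral.integral_congr fun s hs => ?_
      rw [uIcc_of_le ht] at hs
      have hws : w s = (u s - midpt lo hi s) / halfWidth lo hi s := by
        rw [hw, IccExtend_of_mem ht _ hs]
        rfl
      simp only [hws, mul_div_cancel₀ _ (hpos s hs).ne', add_sub_cancel]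
  · rintro ⟨_, ⟨w, hw, hw1, rfl⟩, rfl⟩
    refine ⟨fun s => midpt lo hi s + halfWidth lo hi s * w s, by fun_prop, fun s hs => ?_, ?_⟩
    · have h1 := hpos s hs
      have h2 := abs_le.1 (hw1 s)
      have h3 : midpt lo hi s - halfWidth lo hi s = lo s := by simp only [midpt, halfWidth]; ring
      have h4 : midpt lo hi s + halfWidth lo hi s = hi s := by simp only [midpt, halfWidth]; ring
      constructor <;> nlinarith
    · simp only
      rw [hsplit w hw, add_assoc]

/-- The boundary of the reach set of the integrator for a continuous input range with nonempty
interior. -/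
theorem frontier_reachSet_integrator {t : ℝ} (ht : 0 < t) {lo hi : ℝ → ℝ} (hlo : Continuous lo)
    (hhi : Continuous hi) (hlt : ∀ s ∈ Icc 0 t, lo s < hi s) (x₀ : Fin (m + 1) → ℝ) :
    frontier (reachSet (Aint m) (Pi.single (Fin.last m) 1) lo hi t x₀) =
      upperSurface lo hi t x₀ ∪ lowerSurface lo hi t x₀ := by
  rw [reachSet_eq_translate ht.le hlo hhi hlt]
  set p := chi t x₀ + ∫ s in (0 : ℝ)..t, midpt lo hi s • xi m (t - s) with hp
  have h := (Homeomorph.addLeft p).image_frontier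
    (momentSet (fun s => halfWidth lo hi s • xi m (t - s)) t)
  rw [frontier_momentSet_xi (μ := halfWidth lo hi) ht ((hhi.sub hlo).div_const 2)
    fun s hs => half_pos (sub_pos.2 (hlt s hs))] at h
  rw [show (fun y => p + y) = Homeomorph.addLeft p from rfl, ← h, image_union, image_image,
    image_image]
  refine congrArg₂ _ rfl ?_
  refine image_congr fun σ _ => ?_
  simp only [Homeomorph.coe_addLeft, xLower, ← hp]
  rw [sub_eq_add_neg]

/-- The boundary of the reach set of the integrator for a single admissible input. -/
theorem frontier_reachSet_integrator_of_eq {t : ℝ} (ht : 0 ≤ t) {lo hi : ℝ → ℝ}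
    (hlo : Continuous lo) (hhi : Continuous hi) (heq : ∀ s ∈ Icc 0 t, lo s = hi s) (x₀ : Fin (m + 1) → ℝ) :
    frontier (reachSet (Aint m) (Pi.single (Fin.last m) 1) lo hi t x₀) =
      upperSurface lo hi t x₀ ∪ lowerSurface lo hi t x₀ := by
  have hμ : ∀ s ∈ Icc 0 t, halfWidth lo hi s = 0 := fun s hs => by simp [halfWidth, heq s hs]
  have halt : ∀ σ ∈ weylChamber m t, alternating (halfWidth lo hi) t σ = 0 := fun σ hσ => by
    rw [alternating_eq_integral_sign (μ := halfWidth lo hi) ht hσ ((hhi.sub hlo).div_const 2)]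
    refine intervalIntegral.integral_zero_ae (ae_of_all _ fun s hs => ?_)
    rw [uIoc_of_le ht] at hs
    simp [hμ s ⟨hs.1.le, hs.2⟩]
  set p := chi t x₀ + ∫ s in (0 : ℝ)..t, midpt lo hi s • xi m (t - s) with hp
  have hne : (weylChamber m t).Nonempty := ⟨fun _ => 0, monotone_const, fun _ => ⟨le_rfl, ht⟩⟩
  have hup : upperSurface lo hi t x₀ = {p} := by
    rw [← hne.image_const p]
    exact image_congr fun σ hσ => by simp [xUpper, halt σ hσ, hp]
  have hlow : lowerSurface lo hi t x₀ = {p} := by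
    rw [← hne.image_const p]
    exact image_congr fun σ hσ => by simp [xLower, halt σ hσ, hp]
  have hreach : reachSet (Aint m) (Pi.single (Fin.last m) 1) lo hi t x₀ = {p} := by
    rw [reachSet_integrator ht]
    ext y
    constructor
    · rintro ⟨u, -, hb, rfl⟩
      rw [mem_singleton_iff, hp]
      congr 1
      refine intervalIntegral.integral_congr fun s hs => ?_
      rw [uIcc_of_le ht] at hs
      have h1 := hb s hs
      have h2 : u s = midpt lo hi s := by
        simp only [midpt]
        linarith [h1.1, h1.2, heq s hs]
      simp only [h2]
    · rintro rfl
      refine ⟨midpt lo hi, ((hhi.add hlo).div_const 2).continuousOn, fun s hs => ?_, rfl⟩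
      simp only [midpt, heq s hs, mem_Icc]
      constructor <;> linarith
  have : (𝓝[≠] p).NeBot := Module.punctured_nhds_neBot ℝ _ p
  rw [hup, hlow, hreach, union_self, isClosed_singleton.frontier_eq, interior_singleton,
    sdiff_empty]

end Integrator

section Canonical

variable {m : ℕ}

theorem bcon_eq_single {A : Matrix (Fin (m + 1)) (Fin (m + 1)) ℝ} {b : Fin (m + 1) → ℝ}
    (h : IsControllable A b) : bcon A b = Pi.single (Fin.last m) 1 := by
  have hunit : IsUnit (ctrbMatrix A b) :=
    Matrix.linearIndependent_cols_iff_isUnit.1 <| linearIndependent_iff_card_eq_finrank_span.2 <| by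
      rw [Set.finrank, ← Matrix.rank_eq_finrank_span_cols, h, Fintype.card_fin]
  ext i
  have h1 : bcon A b i = ((ctrbMatrix A b)⁻¹ * ctrbMatrix A b) (Fin.last m) i := by
    simp only [bcon, canonM, Matrix.mulVec, Matrix.of_apply, Matrix.mul_apply]
    change (qRow A b ᵥ* A ^ (i : ℕ)) ⬝ᵥ b = qRow A b ⬝ᵥ (A ^ (i : ℕ) *ᵥ b)
    rw [Matrix.dotProduct_mulVec]
  rw [h1, Matrix.nonsing_inv_mul _ ((Matrix.isUnit_iff_isUnit_det _).1 hunit), Matrix.one_apply,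
    Pi.single_apply]
  simp only [eq_comm]

theorem continuous_exp_smul_mulVec (M : Matrix (Fin (m + 1)) (Fin (m + 1)) ℝ)
    (x : Fin (m + 1) → ℝ) : Continuous fun r : ℝ => NormedSpace.exp (r • M) *ᵥ x := by
  let _ : NormedRing (Matrix (Fin (m + 1)) (Fin (m + 1)) ℝ) := Matrix.linftyOpNormedRing
  let _ : NormedAlgebra ℝ (Matrix (Fin (m + 1)) (Fin (m + 1)) ℝ) := Matrix.linftyOpNormedAlgebra
  have h : Continuous fun r : ℝ => NormedSpace.exp (r • M) :=
    continuous_iff_continuousAt.2 fun r => (hasDerivAt_exp_smul_const' M r).continuousAt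
  exact h.matrix_mulVec continuous_const

/-- The impulse response paired with the coefficients of the characteristic polynomial. -/
noncomputable def impulse (A : Matrix (Fin (m + 1)) (Fin (m + 1)) ℝ) (b : Fin (m + 1) → ℝ)
    (r : ℝ) : ℝ :=
  charCoeff A ⬝ᵥ (NormedSpace.exp (r • Acon A b) *ᵥ bcon A b)

theorem continuous_impulse (A : Matrix (Fin (m + 1)) (Fin (m + 1)) ℝ) (b : Fin (m + 1) → ℝ) :
    Continuous (impulse A b) :=
  continuous_const.dotProduct (continuous_exp_smul_mulVec _ _)

end Canonical

section Extremal

/-- The integral functional over continuous functions with values in `[a, b]` is bounded above by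
its value at the switching function, and this bound is sharp. -/
theorem isLUB_integral_functional {f : ℝ → ℝ} (hf : Continuous f) {s : ℝ} (hs : 0 ≤ s) {a b : ℝ}
    (hab : a ≤ b) :
    IsLUB {r | ∃ v : ℝ → ℝ, ContinuousOn v (Icc 0 s) ∧ (∀ τ ∈ Icc 0 s, v τ ∈ Icc a b) ∧
        r = v s - ∫ τ in (0 : ℝ)..s, f τ * v τ}
      (b - b * (∫ τ in (0 : ℝ)..s, min (f τ) 0) - a * ∫ τ in (0 : ℝ)..s, max (f τ) 0) := by
  have hmin : Continuous fun τ => min (f τ) 0 := hf.min continuous_const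
  have hmax : Continuous fun τ => max (f τ) 0 := hf.max continuous_const
  have hval : b * (∫ τ in (0 : ℝ)..s, min (f τ) 0) + a * (∫ τ in (0 : ℝ)..s, max (f τ) 0) =
      ∫ τ in (0 : ℝ)..s, (b * min (f τ) 0 + a * max (f τ) 0) := by
    rw [intervalIntegral.integral_add ((hmin.const_mul b).intervalIntegrable _ _)
      ((hmax.const_mul a).intervalIntegrable _ _), intervalIntegral.integral_const_mul,
      intervalIntegral.integral_const_mul]
  have hbound : b - b * (∫ τ in (0 : ℝ)..s, min (f τ) 0) - a * (∫ τ in (0 : ℝ)..s, max (f τ) 0) =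
      b - ∫ τ in (0 : ℝ)..s, (b * min (f τ) 0 + a * max (f τ) 0) := by
    rw [← hval]
    ring
  rw [hbound]
  constructor
  · rintro _ ⟨v, hv, hvab, rfl⟩
    refine sub_le_sub (hvab s ⟨hs, le_rfl⟩).2 (intervalIntegral.integral_mono_on hs
      (((hmin.const_mul b).add (hmax.const_mul a)).intervalIntegrable _ _) ?_ fun τ hτ => ?_)
    · refine ContinuousOn.intervalIntegrable ?_
      rw [uIcc_of_le hs]
      exact hf.continuousOn.mul hv
    · have h := hvab τ hτ
      rcases le_total (f τ) 0 with h0 | h0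
      · rw [min_eq_left h0, max_eq_right h0]
        nlinarith [h.2]
      · rw [min_eq_right h0, max_eq_left h0]
        nlinarith [h.1]
  · intro B hB
    set v : ℕ → ℝ → ℝ := fun k τ => b - (b - a) * min 1 (k * (max (f τ) 0 * max (s - τ) 0))
      with hv
    have hvc : ∀ k, Continuous (v k) := fun k => by
      simp only [hv]
      fun_prop
    have hmem : ∀ k τ, v k τ ∈ Icc a b := fun k τ => by
      have h0 : 0 ≤ min 1 ((k : ℝ) * (max (f τ) 0 * max (s - τ) 0)) := by positivity
      have h1 : min 1 ((k : ℝ) * (max (f τ) 0 * max (s - τ) 0)) ≤ 1 := min_le_left _ _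
      simp only [hv, mem_Icc]
      constructor <;> nlinarith
    have hvs : ∀ k, v k s = b := fun k => by simp [hv]
    have hlim : Tendsto (fun k => ∫ τ in (0 : ℝ)..s, f τ * v k τ) atTop
        (𝓝 (∫ τ in (0 : ℝ)..s, (b * min (f τ) 0 + a * max (f τ) 0))) := by
      refine intervalIntegral.tendsto_integral_filter_of_dominated_convergence
        (fun τ => |f τ| * max |a| |b|)
        (Eventually.of_forall fun k => (hf.mul (hvc k)).aestronglyMeasurable)
        (Eventually.of_forall fun k => ae_of_all _ fun τ _ => ?_)
        ((hf.abs.mul continuous_const).intervalIntegrable _ _) ?_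
      · rw [Real.norm_eq_abs, abs_mul]
        exact mul_le_mul_of_nonneg_left (abs_le_max_abs_abs (hmem k τ).1 (hmem k τ).2)
          (abs_nonneg _)
      · filter_upwards [compl_mem_ae_iff.2 (measure_singleton s)] with τ hτs hτ
        rw [uIoc_of_le hs] at hτ
        have hlt : 0 < s - τ := sub_pos.2 (lt_of_le_of_ne hτ.2 hτs)
        rcases le_or_gt (f τ) 0 with h0 | h0
        · have : ∀ k, f τ * v k τ = b * min (f τ) 0 + a * max (f τ) 0 := fun k => by
            simp only [hv, max_eq_right h0, min_eq_left h0]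
            simp [mul_comm]
          simp only [this]
          exact tendsto_const_nhds
        · refine tendsto_const_nhds.congr' ?_
          have hpos : 0 < f τ * (s - τ) := mul_pos h0 hlt
          have hev := (tendsto_natCast_atTop_atTop (R := ℝ)).eventually_ge_atTop
            (1 / (f τ * (s - τ)))
          filter_upwards [hev] with k hk
          rw [div_le_iff₀ hpos] at hk
          simp only [hv, max_eq_left h0.le, max_eq_left hlt.le, min_eq_left hk,
            min_eq_right h0.le]
          ring
    refine le_of_tendsto (hlim.const_sub b) (Eventually.of_forall fun k => hB ?_)
    exact ⟨v k, (hvc k).continuousOn, fun τ _ => hmem k τ, by rw [hvs k]⟩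

theorem isGLB_integral_functional {f : ℝ → ℝ} (hf : Continuous f) {s : ℝ} (hs : 0 ≤ s) {a b : ℝ}
    (hab : a ≤ b) :
    IsGLB {r | ∃ v : ℝ → ℝ, ContinuousOn v (Icc 0 s) ∧ (∀ τ ∈ Icc 0 s, v τ ∈ Icc a b) ∧
        r = v s - ∫ τ in (0 : ℝ)..s, f τ * v τ}
      (a - a * (∫ τ in (0 : ℝ)..s, min (f τ) 0) - b * ∫ τ in (0 : ℝ)..s, max (f τ) 0) := by
  have h := isLUB_integral_functional hf hs (neg_le_neg hab)
  have hset : -{r | ∃ v : ℝ → ℝ, ContinuousOn v (Icc 0 s) ∧ (∀ τ ∈ Icc 0 s, v τ ∈ Icc a b) ∧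
        r = v s - ∫ τ in (0 : ℝ)..s, f τ * v τ} =
      {r | ∃ v : ℝ → ℝ, ContinuousOn v (Icc 0 s) ∧ (∀ τ ∈ Icc 0 s, v τ ∈ Icc (-b) (-a)) ∧
        r = v s - ∫ τ in (0 : ℝ)..s, f τ * v τ} := by
    ext r
    constructor
    · rintro ⟨v, hv, hvab, hr⟩
      refine ⟨fun τ => -v τ, hv.neg, fun τ hτ => ⟨neg_le_neg (hvab τ hτ).2,
        neg_le_neg (hvab τ hτ).1⟩, ?_⟩
      simp only [mul_neg, intervalIntegral.integral_neg]
      linarith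
    · rintro ⟨v, hv, hvab, rfl⟩
      refine ⟨fun τ => -v τ, hv.neg, fun τ hτ => ⟨by linarith [(hvab τ hτ).2],
        by linarith [(hvab τ hτ).1]⟩, ?_⟩
      simp only [mul_neg, intervalIntegral.integral_neg]
      ring
  rw [← isLUB_neg', hset]
  refine (congrArg _ ?_).mp h
  ring

theorem setIntegral_sublevel {f : ℝ → ℝ} (hf : Continuous f) {s : ℝ} (hs : 0 ≤ s) :
    ∫ τ in {τ | τ ∈ Icc 0 s ∧ f τ ≤ 0}, f τ = ∫ τ in (0 : ℝ)..s, min (f τ) 0 := by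
  have hm : MeasurableSet {τ | f τ ≤ 0} := (isClosed_le hf continuous_const).measurableSet
  rw [intervalIntegral.integral_of_le hs, ← integral_Icc_eq_integral_Ioc]
  change ∫ τ in Icc 0 s ∩ {τ | f τ ≤ 0}, f τ = _
  rw [← setIntegral_indicator hm]
  refine integral_congr_ae (ae_of_all _ fun τ => ?_)
  by_cases h : f τ ≤ 0
  · simp [indicator, h]
  · simp [indicator, h, (not_le.1 h).le]

theorem setIntegral_superlevel {f : ℝ → ℝ} (hf : Continuous f) {s : ℝ} (hs : 0 ≤ s) :
    ∫ τ in {τ | τ ∈ Icc 0 s ∧ 0 < f τ}, f τ = ∫ τ in (0 : ℝ)..s, max (f τ) 0 := by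
  have hm : MeasurableSet {τ | 0 < f τ} := (isOpen_lt continuous_const hf).measurableSet
  rw [intervalIntegral.integral_of_le hs, ← integral_Icc_eq_integral_Ioc]
  change ∫ τ in Icc 0 s ∩ {τ | 0 < f τ}, f τ = _
  rw [← setIntegral_indicator hm]
  refine integral_congr_ae (ae_of_all _ fun τ => ?_)
  by_cases h : 0 < f τ
  · simp [indicator, h, h.le]
  · simp [indicator, h, not_lt.1 h]

end Extremal

section Range

variable {m : ℕ} (A : Matrix (Fin (m + 1)) (Fin (m + 1)) ℝ) (b z₀ : Fin (m + 1) → ℝ)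

theorem continuous_kernelF (s : ℝ) : Continuous (kernelF A b s) :=
  (continuous_impulse A b).comp (continuous_const.sub continuous_id)

theorem intSub_eq_integral {s : ℝ} (hs : 0 ≤ s) :
    intSub A b s = ∫ r in (0 : ℝ)..s, min (impulse A b r) 0 := by
  rw [intSub, setIntegral_sublevel (continuous_kernelF A b s) hs]
  have := intervalIntegral.integral_comp_sub_left (a := 0) (b := s)
    (fun r => min (impulse A b r) 0) s
  simpa [impulse, kernelF] using this

theorem intSuper_eq_integral {s : ℝ} (hs : 0 ≤ s) :
    intSuper A b s = ∫ r in (0 : ℝ)..s, max (impulse A b r) 0 := by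
  rw [intSuper, setIntegral_superlevel (continuous_kernelF A b s) hs]
  have := intervalIntegral.integral_comp_sub_left (a := 0) (b := s)
    (fun r => max (impulse A b r) 0) s
  simpa [impulse, kernelF] using this

variable {vmin vmax : ℝ}

theorem isLUB_valuesI (hv : vmin ≤ vmax) {s : ℝ} (hs : 0 ≤ s) :
    IsLUB (valuesI A b vmin vmax s) (vmax - vmax * intSub A b s - vmin * intSuper A b s) := by
  rw [intSub, intSuper, setIntegral_sublevel (continuous_kernelF A b s) hs,
    setIntegral_superlevel (continuous_kernelF A b s) hs]
  exact isLUB_integral_functional (continuous_kernelF A b s) hs hv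

theorem isGLB_valuesI (hv : vmin ≤ vmax) {s : ℝ} (hs : 0 ≤ s) :
    IsGLB (valuesI A b vmin vmax s) (vmin - vmin * intSub A b s - vmax * intSuper A b s) := by
  rw [intSub, intSuper, setIntegral_sublevel (continuous_kernelF A b s) hs,
    setIntegral_superlevel (continuous_kernelF A b s) hs]
  exact isGLB_integral_functional (continuous_kernelF A b s) hs hv

/-- A continuous function on `ℝ` that agrees with `umin` for nonnegative times (and with `umax`
when the roles of `p` and `q` are exchanged). -/
noncomputable def rangeEnd (p q s : ℝ) : ℝ :=
  -(charCoeff A ⬝ᵥ (NormedSpace.exp (s • Acon A b) *ᵥ (canonM A b *ᵥ z₀))) +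
    (p - p * (∫ r in (0 : ℝ)..s, min (impulse A b r) 0) -
      q * ∫ r in (0 : ℝ)..s, max (impulse A b r) 0)

theorem continuous_rangeEnd (p q : ℝ) : Continuous (rangeEnd A b z₀ p q) := by
  have hf := continuous_impulse A b
  have h1 : Continuous fun s => ∫ r in (0 : ℝ)..s, min (impulse A b r) 0 :=
    intervalIntegral.continuous_primitive
      (fun _ _ => (hf.min continuous_const).intervalIntegrable _ _) 0
  have h2 : Continuous fun s => ∫ r in (0 : ℝ)..s, max (impulse A b r) 0 :=
    intervalIntegral.continuous_primitive
      (fun _ _ => (hf.max continuous_const).intervalIntegrable _ _) 0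
  have h3 : Continuous fun s : ℝ =>
      charCoeff A ⬝ᵥ (NormedSpace.exp (s • Acon A b) *ᵥ (canonM A b *ᵥ z₀)) :=
    continuous_const.dotProduct (continuous_exp_smul_mulVec _ _)
  unfold rangeEnd
  fun_prop

theorem rangeEnd_lt {s : ℝ} (hs : 0 ≤ s) (hv : vmin < vmax) :
    rangeEnd A b z₀ vmin vmax s < rangeEnd A b z₀ vmax vmin s := by
  have h1 : ∫ r in (0 : ℝ)..s, min (impulse A b r) 0 ≤ 0 := by
    rw [intervalIntegral.integral_of_le hs]
    exact integral_nonpos fun _ => min_le_right _ _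
  have h2 : 0 ≤ ∫ r in (0 : ℝ)..s, max (impulse A b r) 0 :=
    intervalIntegral.integral_nonneg hs fun _ _ => le_max_right _ _
  simp only [rangeEnd]
  nlinarith

theorem umin_eq_rangeEnd (hv : vmin ≤ vmax) {s : ℝ} (hs : 0 ≤ s) :
    umin A b z₀ vmin vmax s = rangeEnd A b z₀ vmin vmax s := by
  have h := isGLB_valuesI A b hv hs
  have hne : (valuesI A b vmin vmax s).Nonempty :=
    ⟨_, fun _ => vmin, continuousOn_const, fun _ _ => ⟨le_rfl, hv⟩, rfl⟩
  rw [umin, Imin, h.csInf_eq hne, intSub_eq_integral A b hs, intSuper_eq_integral A b hs, rangeEnd]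

theorem umax_eq_rangeEnd (hv : vmin ≤ vmax) {s : ℝ} (hs : 0 ≤ s) :
    umax A b z₀ vmin vmax s = rangeEnd A b z₀ vmax vmin s := by
  have h := isLUB_valuesI A b hv hs
  have hne : (valuesI A b vmin vmax s).Nonempty :=
    ⟨_, fun _ => vmin, continuousOn_const, fun _ _ => ⟨le_rfl, hv⟩, rfl⟩
  rw [umax, Imax, h.csSup_eq hne, intSub_eq_integral A b hs, intSuper_eq_integral A b hs, rangeEnd]

end Range

section Congruence

variable {m : ℕ} {lo lo' hi hi' : ℝ → ℝ} {t : ℝ}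

theorem reachSet_congr (F : Matrix (Fin (m + 1)) (Fin (m + 1)) ℝ) (g x₀ : Fin (m + 1) → ℝ)
    (hlo : EqOn lo lo' (Icc 0 t)) (hhi : EqOn hi hi' (Icc 0 t)) :
    reachSet F g lo hi t x₀ = reachSet F g lo' hi' t x₀ := by
  have h : ∀ u : ℝ → ℝ, (∀ s ∈ Icc 0 t, u s ∈ Icc (lo s) (hi s)) ↔
      ∀ s ∈ Icc 0 t, u s ∈ Icc (lo' s) (hi' s) := fun u =>
    forall₂_congr fun s hs => by rw [hlo hs, hhi hs]
  simp only [reachSet, h]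

theorem nodes_mem_Icc (ht : 0 ≤ t) {σ : Fin m → ℝ} (hσ : σ ∈ weylChamber m t) (k : Fin (m + 2)) :
    nodes t σ k ∈ Icc 0 t := by
  induction k using Fin.cases with
  | zero => exact ⟨le_rfl, ht⟩
  | succ k =>
    induction k using Fin.lastCases with
    | last =>
      rw [nodes_succ_last]
      exact ⟨ht, le_rfl⟩
    | cast j =>
      rw [nodes_succ_castSucc]
      exact hσ.2 j

theorem alternating_congr (ht : 0 ≤ t) {μ μ' : ℝ → ℝ} (h : EqOn μ μ' (Icc 0 t)) {σ : Fin m → ℝ}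
    (hσ : σ ∈ weylChamber m t) : alternating μ t σ = alternating μ' t σ := by
  refine Finset.sum_congr rfl fun k _ => ?_
  congr 1
  refine intervalIntegral.integral_congr fun s hs => ?_
  have hs' : s ∈ Icc 0 t :=
    uIcc_subset_Icc (nodes_mem_Icc ht hσ _) (nodes_mem_Icc ht hσ _) hs
  simp only [h hs']

theorem integral_midpt_congr (ht : 0 ≤ t) (hlo : EqOn lo lo' (Icc 0 t))
    (hhi : EqOn hi hi' (Icc 0 t)) :
    ∫ s in (0 : ℝ)..t, midpt lo hi s • xi m (t - s) =
      ∫ s in (0 : ℝ)..t, midpt lo' hi' s • xi m (t - s) := by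
  refine intervalIntegral.integral_congr fun s hs => ?_
  rw [uIcc_of_le ht] at hs
  simp only [midpt, hlo hs, hhi hs]

theorem upperSurface_congr (ht : 0 ≤ t) (hlo : EqOn lo lo' (Icc 0 t))
    (hhi : EqOn hi hi' (Icc 0 t)) (x₀ : Fin (m + 1) → ℝ) :
    upperSurface lo hi t x₀ = upperSurface lo' hi' t x₀ := by
  refine image_congr fun σ hσ => ?_
  have hμ : EqOn (halfWidth lo hi) (halfWidth lo' hi') (Icc 0 t) := fun s hs => by
    simp only [halfWidth, hlo hs, hhi hs]
  rw [xUpper, xUpper, integral_midpt_congr ht hlo hhi, alternating_congr ht hμ hσ]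

theorem lowerSurface_congr (ht : 0 ≤ t) (hlo : EqOn lo lo' (Icc 0 t))
    (hhi : EqOn hi hi' (Icc 0 t)) (x₀ : Fin (m + 1) → ℝ) :
    lowerSurface lo hi t x₀ = lowerSurface lo' hi' t x₀ := by
  refine image_congr fun σ hσ => ?_
  have hμ : EqOn (halfWidth lo hi) (halfWidth lo' hi') (Icc 0 t) := fun s hs => by
    simp only [halfWidth, hlo hs, hhi hs]
  rw [xLower, xLower, integral_midpt_congr ht hlo hhi, alternating_congr ht hμ hσ]

end Congruence

end Reach

theorem corollary1 {m : ℕ} (A : Matrix (Fin (m + 1)) (Fin (m + 1)) ℝ)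
    (b z₀ : Fin (m + 1) → ℝ) (hAb : Reach.IsControllable A b)
    (vmin vmax : ℝ) (hv : vmin ≤ vmax) (t : ℝ) (ht : 0 < t) :
    (∀ s ∈ Set.Icc 0 t,
      IsGLB (Reach.valuesI A b vmin vmax s)
        (vmin - vmin * Reach.intSub A b s - vmax * Reach.intSuper A b s) ∧
      IsLUB (Reach.valuesI A b vmin vmax s)
        (vmax - vmax * Reach.intSub A b s - vmin * Reach.intSuper A b s)) ∧
    frontier (Reach.reachSet (Reach.Aint m) (Reach.bcon A b)
        (Reach.umin A b z₀ vmin vmax) (Reach.umax A b z₀ vmin vmax) t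
        (Reach.canonM A b *ᵥ z₀)) =
      Reach.upperSurface (Reach.umin A b z₀ vmin vmax) (Reach.umax A b z₀ vmin vmax) t
          (Reach.canonM A b *ᵥ z₀) ∪
        Reach.lowerSurface (Reach.umin A b z₀ vmin vmax) (Reach.umax A b z₀ vmin vmax) t
          (Reach.canonM A b *ᵥ z₀) := by
  refine ⟨fun s hs => ⟨Reach.isGLB_valuesI A b hv hs.1, Reach.isLUB_valuesI A b hv hs.1⟩, ?_⟩
  have hlo : Set.EqOn (Reach.umin A b z₀ vmin vmax) (Reach.rangeEnd A b z₀ vmin vmax)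
      (Set.Icc 0 t) := fun s hs => Reach.umin_eq_rangeEnd A b z₀ hv hs.1
  have hhi : Set.EqOn (Reach.umax A b z₀ vmin vmax) (Reach.rangeEnd A b z₀ vmax vmin)
      (Set.Icc 0 t) := fun s hs => Reach.umax_eq_rangeEnd A b z₀ hv hs.1
  rw [Reach.bcon_eq_single hAb, Reach.reachSet_congr _ _ _ hlo hhi,
    Reach.upperSurface_congr ht.le hlo hhi, Reach.lowerSurface_congr ht.le hlo hhi]
  have hc := Reach.continuous_rangeEnd A b z₀
  rcases hv.lt_or_eq with hlt | rfl
  · exact Reach.frontier_reachSet_integrator ht (hc _ _) (hc _ _)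
      (fun s hs => Reach.rangeEnd_lt A b z₀ hs.1 hlt) _
  · exact Reach.frontier_reachSet_integrator_of_eq ht.le (hc _ _) (hc _ _) (fun _ _ => rfl) _
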